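/- **Theorem.** Let $n\ge 1$. There is a constant $c_n$ depending only on the dimension $n$ such that for every weight $u\in A_1$ on $\mathbb R^n$ and every measurable function $f$ on $\mathbb R^n$, $$\Big\|\frac{M(fu)}{u}\Big\|_{L^{1,\infty}(u^2)}\le c_n\,[u]_{A_1}^2\,\|f\|_{L^1(u^2)}.$$ Here a weight is a locally integrable function on $\mathbb R^n$ that is positive almost everywhere; cubes are cubes of positive side length with sides parallel to the coordinate axes; $$Mg(x)=\sup_{Q\ni x}\frac1{|Q|}\int_Q|g(y)|\,dy$$ is the (non-centred) Hardy–Littlewood maximal function, the supremum being over all cubes $Q$ containing $x$; $$[u]_{A_1}=\sup_Q\Big(\frac1{|Q|}\int_Q u\Big)\Big(\operatorname*{ess\,inf}_{Q}u\Big)^{-1},$$ the supremum being over all cubes, and $u\in A_1$ means $[u]_{A_1}<\infty$; finally $$\|f\|_{L^1(u^2)}=\int_{\mathbb R^n}|f|\,u^2\,dx,\qquad \|h\|_{L^{1,\infty}(u^2)}=\sup_{t>0}\,t\int_{\{|h|>t\}}u^2\,dx.$$ (This is the case $u=v$ of the conjectured estimate $\|M(fv)/v\|_{L^{1,\infty}(uv)}\le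 c_n[u]_{A_1}[v]_{A_1}\|f\|_{L^1(uv)}$ for $u,v\in A_1$.) -/

import Mathlib

open MeasureTheory
open scoped ENNReal NNReal

namespace WeightedBounds

noncomputable section

/-- The closed cube in `ℝⁿ` with sides parallel to the axes, lower corner `a` and side length `s`. -/
def cube {n : ℕ} (a : Fin n → ℝ) (s : ℝ) : Set (Fin n → ℝ) :=
  Set.Icc a (fun i => a i + s)

/-- The (non-centred) Hardy-Littlewood maximal function: the supremum of the averages of `|g|`
over all cubes of positive side length that contain the point. -/
def maximalFunction {n : ℕ} (g : (Fin n → ℝ) → ℂ) (x : Fin n → ℝ) : ℝ≥0∞ :=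
  ⨆ (a : Fin n → ℝ) (s : ℝ) (_ : 0 < s) (_ : x ∈ cube a s), ⨍⁻ y in cube a s, ‖g y‖ₑ ∂volume

/-- A weight on `ℝⁿ`: a locally integrable function that is positive almost everywhere. -/
structure IsWeight {n : ℕ} (u : (Fin n → ℝ) → ℝ) : Prop where
  locallyIntegrable : LocallyIntegrable u volume
  pos : ∀ᵐ x, 0 < u x

/-- The `A₁` constant: the supremum over all cubes of the average of `u` divided by the essential
infimum of `u` (it is infinite if the essential infimum of a weight vanishes on some cube). -/
def A1Const {n : ℕ} (u : (Fin n → ℝ) → ℝ) : ℝ≥0∞ :=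
  ⨆ (a : Fin n → ℝ) (s : ℝ) (_ : 0 < s),
    (⨍⁻ y in cube a s, ENNReal.ofReal (u y) ∂volume) /
      essInf (fun y => ENNReal.ofReal (u y)) (volume.restrict (cube a s))

/-- The class `A₁`. -/
structure IsA1 {n : ℕ} (u : (Fin n → ℝ) → ℝ) : Prop extends IsWeight u where
  const_lt_top : A1Const u < ∞

/-- The measure `w(x) dx`. -/
def weightMeasure {n : ℕ} (w : (Fin n → ℝ) → ℝ) : Measure (Fin n → ℝ) :=
  volume.withDensity (fun x => ENNReal.ofReal (w x))

/-- The `L^{1,∞}(μ)` quasi-norm of a nonnegative function, `sup_{t > 0} t · μ {h > t}`. -/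
def weakL1Norm {α : Type*} [MeasurableSpace α] (h : α → ℝ≥0∞) (μ : Measure α) : ℝ≥0∞ :=
  ⨆ (t : ℝ≥0) (_ : 0 < t), (t : ℝ≥0∞) * μ {x | (t : ℝ≥0∞) < h x}

end

end WeightedBounds

namespace WeightedBounds

open Set Filter Topology

/-! Write `w` for the weight, `K` for its `A₁` constant, `g = |f| w` and `A = 2 ^ (n + 1)`. Slice
space into the sets `E k` where `A ^ k < w ≤ A ^ (k + 1)`. On `E k`, a cube witnessing `M g > t w`
has average of `g` above `t A ^ k`, so Vitali's lemma gives disjoint cubes of this kind whose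
fivefold enlargements `Q*` cover that part of the level set. As `w ^ 2 ≤ A ^ (k + 1) w` on `E k`,
each `Q` contributes at most a dimensional constant times `φ k Q * ∫_Q g`, where `φ k Q = w(Q* ∩ E
k) / |Q*|`.

It remains to bound, for almost every `x`, the sum over `k` of `φ k Q` for the at most one cube `Q`
of level `k` containing `x`. The `A₁` condition bounds the average of `w` over `Q*` by `z = K w(x)`.
Levels below `z` give a geometric series, since `φ k Q ≤ A ^ (k + 1)`. For levels at least `A ^ m
z`, `setLIntegral_levelSet_le` gives `φ k Q ≤ (1 - 1/(2K)) ^ m z`, with sum `2 K z`. Thus the total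
is `O(K ^ 2 w(x))`, and `∫ g w = ∫ |f| w ^ 2`.

The decay comes from iterating Calderón–Zygmund decompositions: each selected union fills at most
half of its cube, hence by `A₁` misses a fraction `1/(2K)` of the mass. -/

/-- The half-open cube with lower corner `a` and side length `s`. -/
def halfOpenCube {n : ℕ} (a : Fin n → ℝ) (s : ℝ) : Set (Fin n → ℝ) :=
  univ.pi fun i => Ico (a i) (a i + s)

/-- The multi-index of the dyadic subcube of generation `j` that contains `x`, in the dyadic grid
generated by the half-open cube with lower corner `a` and side length `s`. -/
noncomputable def dyadicIndex {n : ℕ} (a : Fin n → ℝ) (s : ℝ) (j : ℕ) (x : Fin n → ℝ) :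
    Fin n → ℤ :=
  fun i => ⌊(x i - a i) / s * 2 ^ j⌋

/-- The dyadic cube of generation `p.1` and multi-index `p.2` in the dyadic grid generated by the
half-open cube with lower corner `a` and side length `s`. -/
noncomputable def dyadicCube {n : ℕ} (a : Fin n → ℝ) (s : ℝ) (p : ℕ × (Fin n → ℤ)) :
    Set (Fin n → ℝ) :=
  halfOpenCube (fun i => a i + p.2 i * (s / 2 ^ p.1)) (s / 2 ^ p.1)

/-! ### Half-open cubes and the dyadic grid. -/

section Cubes

variable {n : ℕ} {a : Fin n → ℝ} {s : ℝ}

lemma measurableSet_halfOpenCube : MeasurableSet (halfOpenCube a s) :=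
  MeasurableSet.univ_pi fun _ => measurableSet_Ico

lemma measurableSet_dyadicCube {p : ℕ × (Fin n → ℤ)} : MeasurableSet (dyadicCube a s p) :=
  measurableSet_halfOpenCube

lemma volume_halfOpenCube : volume (halfOpenCube a s) = ENNReal.ofReal s ^ n := by
  simp [halfOpenCube, Real.volume_pi_Ico]

/-- Dyadic subdivision needs half-open cubes, the maximal function uses closed ones; the null
boundary allows passing between them. -/
lemma halfOpenCube_ae_eq_cube : halfOpenCube a s =ᵐ[volume] cube a s :=
  Measure.univ_pi_Ico_ae_eq_Icc

lemma volume_halfOpenCube_ne_zero (hs : 0 < s) : volume (halfOpenCube a s) ≠ 0 := by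
  rw [volume_halfOpenCube]
  exact pow_ne_zero _ (by simpa using hs)

lemma volume_halfOpenCube_ne_top : volume (halfOpenCube a s) ≠ ∞ := by
  rw [volume_halfOpenCube]
  exact ENNReal.pow_ne_top ENNReal.ofReal_ne_top

lemma cube_eq_closedBall (hs : 0 ≤ s) : cube a s = Metric.closedBall (fun i => a i + s / 2) (s / 2) := by
  rw [closedBall_pi _ (by positivity), cube, ← pi_univ_Icc]
  congr 1
  ext i : 1
  rw [Real.closedBall_eq_Icc]
  congr 1 <;> ring

lemma mem_dyadicCube_iff (hs : 0 < s) {p : ℕ × (Fin n → ℤ)} {x : Fin n → ℝ} :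
    x ∈ dyadicCube a s p ↔ dyadicIndex a s p.1 x = p.2 := by
  have h2 : (0 : ℝ) < 2 ^ p.1 := by positivity
  simp only [dyadicCube, halfOpenCube, mem_univ_pi, mem_Ico, funext_iff, dyadicIndex,
    Int.floor_eq_iff]
  refine forall_congr' fun i => and_congr ?_ ?_
  · rw [← sub_nonneg, ← sub_nonneg (b := (p.2 i : ℝ)),
      show (x i - a i) / s * 2 ^ p.1 - p.2 i
        = (x i - (a i + p.2 i * (s / 2 ^ p.1))) * (2 ^ p.1 / s) by field_simp; ring]
    exact (mul_nonneg_iff_of_pos_right (by positivity)).symm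
  · rw [← sub_pos, ← sub_pos (a := (p.2 i + 1 : ℝ)),
      show (p.2 i + 1 : ℝ) - (x i - a i) / s * 2 ^ p.1
        = (a i + p.2 i * (s / 2 ^ p.1) + s / 2 ^ p.1 - x i) * (2 ^ p.1 / s) by field_simp; ring]
    exact (mul_pos_iff_of_pos_right (by positivity)).symm

lemma dyadicCube_zero : dyadicCube a s (0, 0) = halfOpenCube a s := by
  simp [dyadicCube]

lemma dyadicIndex_zero (hs : 0 < s) {x : Fin n → ℝ} (hx : x ∈ halfOpenCube a s) :
    dyadicIndex a s 0 x = 0 := by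
  rwa [← dyadicCube_zero, mem_dyadicCube_iff hs] at hx

/-- Grids are nested because a coarser index is the integer quotient of a finer one by a power of
two. -/
lemma dyadicIndex_eq_of_le {i j : ℕ} (hij : i ≤ j) {x y : Fin n → ℝ}
    (h : dyadicIndex a s j x = dyadicIndex a s j y) :
    dyadicIndex a s i x = dyadicIndex a s i y := by
  have key : ∀ z, dyadicIndex a s i z = fun l => dyadicIndex a s j z l / ((2 ^ (j - i) : ℕ) : ℤ) := by
    intro z
    ext l
    rw [dyadicIndex, dyadicIndex, ← Int.floor_div_natCast]
    congr 1
    obtain ⟨d, rfl⟩ := Nat.exists_eq_add_of_le hij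
    rw [Nat.add_sub_cancel_left, pow_add]
    push_cast
    field_simp
  rw [key x, key y, h]

lemma volume_dyadicCube (p : ℕ × (Fin n → ℤ)) :
    volume (dyadicCube a s p) = ENNReal.ofReal (s / 2 ^ p.1) ^ n :=
  volume_halfOpenCube

lemma volume_dyadicCube_eq_mul_succ (j : ℕ) (k k' : Fin n → ℤ) :
    volume (dyadicCube a s (j, k)) = 2 ^ n * volume (dyadicCube a s (j + 1, k')) := by
  rw [volume_dyadicCube, volume_dyadicCube, ← mul_pow]
  congr 1
  rw [show (2 : ℝ≥0∞) = ENNReal.ofReal 2 by simp, ← ENNReal.ofReal_mul (by norm_num)]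
  congr 1
  simp only [pow_succ]
  field_simp

lemma dyadicCube_subset (hs : 0 < s) {i j : ℕ} (hij : i ≤ j) (x : Fin n → ℝ) :
    dyadicCube a s (j, dyadicIndex a s j x) ⊆ dyadicCube a s (i, dyadicIndex a s i x) := by
  intro y hy
  rw [mem_dyadicCube_iff hs] at hy ⊢
  exact dyadicIndex_eq_of_le hij hy

lemma dyadicCube_subset_halfOpenCube (hs : 0 < s) (j : ℕ) {x : Fin n → ℝ}
    (hx : x ∈ halfOpenCube a s) : dyadicCube a s (j, dyadicIndex a s j x) ⊆ halfOpenCube a s := by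
  have := dyadicCube_subset hs (Nat.zero_le j) x (a := a)
  rwa [dyadicIndex_zero hs hx, dyadicCube_zero] at this

end Cubes

/-! ### Calderón–Zygmund decomposition. -/

section CalderonZygmund

variable {n : ℕ} {w : (Fin n → ℝ) → ℝ≥0∞} {a : Fin n → ℝ} {s : ℝ}

/-- Lebesgue differentiation along dyadic cubes. -/
lemma ae_le_of_forall_dyadicCube (hw : Measurable w) (hs : 0 < s)
    (hfin : ∫⁻ y in halfOpenCube a s, w y ≠ ∞) (L : ℝ≥0∞) :
    ∀ᵐ x, x ∈ halfOpenCube a s →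
      (∀ j, ∫⁻ y in dyadicCube a s (j, dyadicIndex a s j x), w y ≤
        L * volume (dyadicCube a s (j, dyadicIndex a s j x))) → w x ≤ L := by
  have hQ : MeasurableSet (halfOpenCube a s) := measurableSet_halfOpenCube
  have hf : ∫⁻ y, (halfOpenCube a s).indicator w y ≠ ∞ := by rwa [lintegral_indicator hQ]
  filter_upwards [(IsUnifLocDoublingMeasure.vitaliFamily (volume : Measure (Fin n → ℝ))
    1).ae_tendsto_lintegral_div (hw.indicator hQ).aemeasurable hf] with x hx hxQ hav
  have hδ : ∀ j : ℕ, 0 < s / 2 ^ j := fun j => by positivity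
  set c : ℕ → Fin n → ℝ := fun j i => a i + dyadicIndex a s j x i * (s / 2 ^ j)
  have hball : ∀ j, dyadicCube a s (j, dyadicIndex a s j x) =ᵐ[volume]
      Metric.closedBall (fun i => c j i + s / 2 ^ j / 2) (s / 2 ^ j / 2) := fun j => by
    rw [← cube_eq_closedBall (hδ j).le]
    exact halfOpenCube_ae_eq_cube
  have hmem : ∀ j, x ∈ Metric.closedBall (fun i => c j i + s / 2 ^ j / 2) (s / 2 ^ j / 2) := by
    intro j
    have hxj : x ∈ dyadicCube a s (j, dyadicIndex a s j x) := (mem_dyadicCube_iff hs).2 rfl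
    rw [← cube_eq_closedBall (hδ j).le, cube, ← pi_univ_Icc]
    exact fun i hi => Ico_subset_Icc_self (hxj i hi)
  have hlim : Tendsto (fun j : ℕ => s / 2 ^ j / 2) atTop (𝓝[>] 0) := by
    refine tendsto_nhdsWithin_iff.2 ⟨?_, Eventually.of_forall fun j => by
      have := hδ j; simp only [mem_Ioi]; positivity⟩
    have := (tendsto_pow_atTop_nhds_zero_of_lt_one (r := (1 / 2 : ℝ)) (by norm_num)
      (by norm_num)).const_mul (s / 2)
    simp only [mul_zero] at this
    refine this.congr fun j => ?_
    rw [one_div, inv_pow]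
    field_simp
  -- The dyadic cubes contain `x` without being centred there; the Vitali family with parameter `1`
  -- permits this.
  have ht := hx.comp (IsUnifLocDoublingMeasure.tendsto_closedBall_filterAt volume (K := 1) (x := x)
    (fun j i => c j i + s / 2 ^ j / 2) (fun j => s / 2 ^ j / 2) hlim
    (Eventually.of_forall fun j => by simpa only [one_mul] using hmem j))
  rw [indicator_of_mem hxQ] at ht
  refine le_of_tendsto ht (Eventually.of_forall fun j => ?_)
  simp only [Function.comp_apply]
  rw [← measure_congr (hball j), ← setLIntegral_congr (hball j)]
  refine ENNReal.div_le_of_le_mul (le_trans ?_ (hav j))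
  exact lintegral_mono fun y => indicator_le_self _ _ _

/-- Calderón–Zygmund decomposition of a cube. -/
lemma exists_calderonZygmund (hw : Measurable w) (hs : 0 < s)
    (hfin : ∫⁻ y in halfOpenCube a s, w y ≠ ∞) {L : ℝ≥0∞}
    (hL : ∫⁻ y in halfOpenCube a s, w y ≤ L * volume (halfOpenCube a s)) :
    ∃ S : Set (ℕ × (Fin n → ℤ)), S.PairwiseDisjoint (dyadicCube a s) ∧
      (∀ p ∈ S, dyadicCube a s p ⊆ halfOpenCube a s) ∧
      (∀ p ∈ S, L * volume (dyadicCube a s p) < ∫⁻ y in dyadicCube a s p, w y) ∧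
      (∀ p ∈ S, ∫⁻ y in dyadicCube a s p, w y ≤ 2 ^ n * L * volume (dyadicCube a s p)) ∧
      ∀ᵐ x, x ∈ halfOpenCube a s → x ∉ ⋃ p ∈ S, dyadicCube a s p → w x ≤ L := by
  set D := dyadicCube a s with hD
  set I := dyadicIndex a s with hI
  -- Select the maximal dyadic cubes with average above `L`: every strict ancestor has average at
  -- most `L`.
  refine ⟨{p | D p ⊆ halfOpenCube a s ∧ L * volume (D p) < ∫⁻ y in D p, w y ∧
    ∀ x ∈ D p, ∀ i < p.1, ∫⁻ y in D (i, I i x), w y ≤ L * volume (D (i, I i x))},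
    ?_, fun p hp => hp.1, fun p hp => hp.2.1, ?_, ?_⟩
  · intro p hp q hq hpq
    refine disjoint_left.2 fun z hzp hzq => hpq ?_
    have hp2 := (mem_dyadicCube_iff hs).1 hzp
    have hq2 := (mem_dyadicCube_iff hs).1 hzq
    rcases lt_trichotomy p.1 q.1 with h | h | h
    · have := hq.2.2 z hzq _ h
      rw [show (p.1, I p.1 z) = p from Prod.ext rfl hp2] at this
      exact absurd hp.2.1 (not_lt.2 this)
    · exact Prod.ext h (by rw [← hp2, ← hq2, h])
    · have := hp.2.2 z hzp _ h
      rw [show (q.1, I q.1 z) = q from Prod.ext rfl hq2] at this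
      exact absurd hq.2.1 (not_lt.2 this)
  · rintro ⟨j, k⟩ ⟨hsub, hlt, hanc⟩
    have hx : (fun i => a i + k i * (s / 2 ^ j)) ∈ D (j, k) := by
      simp only [hD, dyadicCube, halfOpenCube, mem_univ_pi, mem_Ico, le_refl, true_and]
      intro i
      have : 0 < s / 2 ^ j := by positivity
      linarith
    set x : Fin n → ℝ := fun i => a i + k i * (s / 2 ^ j)
    have hk : I j x = k := (mem_dyadicCube_iff hs).1 hx
    rcases j with _ | j
    -- The whole cube is never selected, by `hL`; any other selected cube has a parent with average
    -- at most `L`.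
    · have h0 : k = 0 := by rw [← hk]; exact dyadicIndex_zero hs (hsub hx)
      rw [h0, hD, dyadicCube_zero] at hlt
      exact absurd hlt (not_lt.2 hL)
    · calc ∫⁻ y in D (j + 1, k), w y ≤ ∫⁻ y in D (j, I j x), w y := by
            refine lintegral_mono_set ?_
            rw [← hk]
            exact dyadicCube_subset hs (Nat.le_succ j) x
        _ ≤ L * volume (D (j, I j x)) := hanc x hx j (Nat.lt_succ_self j)
        _ = 2 ^ n * L * volume (D (j + 1, k)) := by
            rw [hD, volume_dyadicCube_eq_mul_succ j _ k]; ring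
  · filter_upwards [ae_le_of_forall_dyadicCube hw hs hfin L] with x hx hxQ hxU
    refine hx hxQ fun j => ?_
    -- The first generation with large average would be selected, putting `x` in the union.
    induction j using Nat.strong_induction_on with
    | _ j ih =>
      by_contra! hlt
      refine hxU (mem_biUnion (x := (j, I j x)) ?_ ((mem_dyadicCube_iff hs).2 rfl))
      refine ⟨dyadicCube_subset_halfOpenCube hs j hxQ, hlt, fun y hy i hi => ?_⟩
      have : I i y = I i x := dyadicIndex_eq_of_le hi.le ((mem_dyadicCube_iff hs).1 hy)
      rw [this]
      exact ih i hi

end CalderonZygmund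

/-! ### Decay of the weight on its high level sets. -/

section Decay

variable {n : ℕ} {w : (Fin n → ℝ) → ℝ≥0∞} {K : ℝ≥0∞}

/-- A subset of at most half the measure of a cube misses a fixed proportion of the mass of an `A₁`
weight. -/
lemma setLIntegral_le_of_two_mul_volume_le (hK : K ≠ ∞) (hK0 : K ≠ 0)
    {a : Fin n → ℝ} {s : ℝ} (hs : 0 < s)
    (hfin : ∫⁻ y in halfOpenCube a s, w y ≠ ∞)
    (hA : ∀ᵐ x, x ∈ halfOpenCube a s →
      ∫⁻ y in halfOpenCube a s, w y ≤ K * w x * volume (halfOpenCube a s))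
    {U : Set (Fin n → ℝ)} (hU : MeasurableSet U) (hUQ : U ⊆ halfOpenCube a s)
    (hvol : 2 * volume U ≤ volume (halfOpenCube a s)) :
    ∫⁻ y in U, w y ≤ (1 - (2 * K)⁻¹) * ∫⁻ y in halfOpenCube a s, w y := by
  set Q := halfOpenCube a s
  have hQ : MeasurableSet Q := measurableSet_halfOpenCube
  have hQ0 : volume Q ≠ 0 := volume_halfOpenCube_ne_zero hs
  have hQt : volume Q ≠ ∞ := volume_halfOpenCube_ne_top
  set I := ∫⁻ y in Q, w y with hI
  have hsum : (∫⁻ y in U, w y) + ∫⁻ y in Q \ U, w y = I := by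
    have := lintegral_inter_add_sdiff (μ := volume) w Q hU
    rwa [inter_eq_self_of_subset_right hUQ] at this
  have hvQ : volume Q ≤ 2 * volume (Q \ U) := by
    have h1 : volume U + volume (Q \ U) = volume Q := by
      have := measure_inter_add_sdiff (μ := volume) Q hU
      rwa [inter_eq_self_of_subset_right hUQ] at this
    refine (ENNReal.add_le_add_iff_left hQt).1 ?_
    calc volume Q + volume Q = 2 * volume U + 2 * volume (Q \ U) := by
          rw [← two_mul, ← mul_add, h1]
      _ ≤ volume Q + 2 * volume (Q \ U) := by gcongr
  -- Integrate the `A₁` inequality over `Q \ U`, which has at least half the volume of `Q`.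
  have hlow : I ≤ 2 * K * ∫⁻ y in Q \ U, w y := by
    refine (ENNReal.mul_le_mul_iff_left hQ0 hQt).1 ?_
    calc I * volume Q ≤ I * (2 * volume (Q \ U)) := by gcongr
      _ = 2 * ∫⁻ _ in Q \ U, I := by rw [setLIntegral_const]; ring
      _ ≤ 2 * ∫⁻ y in Q \ U, K * volume Q * w y := by
          refine mul_le_mul_right (setLIntegral_mono_ae' (hQ.diff hU) ?_) 2
          filter_upwards [hA] with y hy hyU
          refine (hy hyU.1).trans (le_of_eq ?_)
          ring
      _ = 2 * (K * volume Q * ∫⁻ y in Q \ U, w y) := by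
          rw [lintegral_const_mul' _ _ (ENNReal.mul_ne_top hK hQt)]
      _ = 2 * K * (∫⁻ y in Q \ U, w y) * volume Q := by ring
  have h2K0 : 2 * K ≠ 0 := mul_ne_zero two_ne_zero hK0
  have h2Kt : 2 * K ≠ ∞ := ENNReal.mul_ne_top ENNReal.ofNat_ne_top hK
  have hlow' : (2 * K)⁻¹ * I ≤ ∫⁻ y in Q \ U, w y := by
    rw [mul_comm, ← div_eq_mul_inv]
    exact ENNReal.div_le_of_le_mul' hlow
  have hdt : ∫⁻ y in Q \ U, w y ≠ ∞ :=
    ne_top_of_le_ne_top hfin (lintegral_mono_set sdiff_subset)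
  calc ∫⁻ y in U, w y = I - ∫⁻ y in Q \ U, w y := ENNReal.eq_sub_of_add_eq hdt hsum
    _ ≤ I - (2 * K)⁻¹ * I := tsub_le_tsub_left hlow' _
    _ = (1 - (2 * K)⁻¹) * I := by
        rw [ENNReal.sub_mul (fun _ _ => hfin), one_mul]

/-- Exponential decay of the mass of an `A₁` weight on its high level sets, which is the
discrete form of the sharp reverse Hölder inequality. -/
theorem setLIntegral_levelSet_le (hw : Measurable w) (hK : K ≠ ∞) (hK0 : K ≠ 0)
    (hfin : ∀ (a : Fin n → ℝ) s, 0 < s → ∫⁻ y in halfOpenCube a s, w y ≠ ∞)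
    (hA : ∀ (a : Fin n → ℝ) s, 0 < s → ∀ᵐ x, x ∈ halfOpenCube a s →
      ∫⁻ y in halfOpenCube a s, w y ≤ K * w x * volume (halfOpenCube a s))
    (m : ℕ) : ∀ (a : Fin n → ℝ) (s : ℝ) (_ : 0 < s) (L : ℝ≥0∞)
      (_ : ∫⁻ y in halfOpenCube a s, w y ≤ L * volume (halfOpenCube a s)),
      ∫⁻ y in halfOpenCube a s ∩ {y | (2 ^ (n + 1)) ^ m * L < w y}, w y ≤
        (1 - (2 * K)⁻¹) ^ m * ∫⁻ y in halfOpenCube a s, w y := by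
  induction m with
  | zero =>
    intro a s _ L _
    simp only [pow_zero, one_mul]
    exact lintegral_mono_set inter_subset_left
  | succ m ih =>
    intro a s hs L hL
    rcases eq_or_ne (∫⁻ y in halfOpenCube a s, w y) 0 with h0 | h0
    · exact (lintegral_mono_set inter_subset_left).trans (by simp [h0])
    rcases eq_or_ne L ∞ with rfl | hLt
    · simp [ENNReal.mul_top]
    have hL0 : L ≠ 0 := by
      rintro rfl
      exact h0 (by simpa using hL)
    -- Stopping at height `2 * L` rather than `L` makes the selected cubes fill at most half of the
    -- cube.
    have hL2 : ∫⁻ y in halfOpenCube a s, w y ≤ 2 * L * volume (halfOpenCube a s) := by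
      refine hL.trans ?_
      rw [mul_assoc]
      exact le_mul_of_one_le_left' one_le_two
    obtain ⟨S, hdisj, hsub, hlt, hle, hae⟩ := exists_calderonZygmund hw hs (hfin a s hs) hL2
    have hSc : S.Countable := S.to_countable
    have hUm : MeasurableSet (⋃ p ∈ S, dyadicCube a s p) :=
      MeasurableSet.biUnion hSc fun p _ => measurableSet_dyadicCube
    have hUQ : ⋃ p ∈ S, dyadicCube a s p ⊆ halfOpenCube a s := iUnion₂_subset hsub
    have hUw : ∫⁻ y in ⋃ p ∈ S, dyadicCube a s p, w y = ∑' p : S, ∫⁻ y in dyadicCube a s p, w y :=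
      lintegral_biUnion hSc (fun p _ => measurableSet_dyadicCube) hdisj w
    have hvol : 2 * volume (⋃ p ∈ S, dyadicCube a s p) ≤ volume (halfOpenCube a s) := by
      refine (ENNReal.mul_le_mul_iff_right hL0 hLt).1 ?_
      calc L * (2 * volume (⋃ p ∈ S, dyadicCube a s p))
          = ∑' p : S, 2 * L * volume (dyadicCube a s p) := by
            rw [measure_biUnion hSc hdisj fun p _ => measurableSet_dyadicCube,
              ENNReal.tsum_mul_left]
            ring
        _ ≤ ∑' p : S, ∫⁻ y in dyadicCube a s p, w y :=
            ENNReal.tsum_le_tsum fun p => (hlt p p.2).le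
        _ ≤ ∫⁻ y in halfOpenCube a s, w y := hUw ▸ lintegral_mono_set hUQ
        _ ≤ L * volume (halfOpenCube a s) := hL
    -- The selected cubes have averages at most `2 ^ n * (2 * L)`, which fixes the ratio `2 ^ (n +
    -- 1)` and lets `ih` apply to each at its own height.
    have hlevel : (2 : ℝ≥0∞) ^ n * (2 * L) = 2 ^ (n + 1) * L := by ring
    calc ∫⁻ y in halfOpenCube a s ∩ {y | (2 ^ (n + 1)) ^ (m + 1) * L < w y}, w y
        ≤ ∫⁻ y in ⋃ p : S, dyadicCube a s p ∩ {y | (2 ^ (n + 1)) ^ m * (2 ^ n * (2 * L)) < w y},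
            w y := by
          refine lintegral_mono_set' ?_
          filter_upwards [hae] with x hx hxQ
          have hlt' : (2 ^ (n + 1)) ^ m * (2 ^ n * (2 * L)) < w x := by
            have := hxQ.2
            rw [mem_ofPred_eq, pow_succ, mul_assoc] at this
            rwa [hlevel]
          have hxU : x ∈ ⋃ p ∈ S, dyadicCube a s p := by
            by_contra hxU
            refine (hx hxQ.1 hxU).not_gt (lt_of_le_of_lt ?_ hlt')
            rw [← mul_assoc]
            have h1 (i : ℕ) : (1 : ℝ≥0∞) ≤ 2 ^ i := one_le_pow_of_one_le' one_le_two i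
            exact le_mul_of_one_le_left' (one_le_mul (one_le_pow_of_one_le' (h1 _) _) (h1 _))
          obtain ⟨p, hp, hxp⟩ := mem_iUnion₂.1 hxU
          exact mem_iUnion.2 ⟨⟨p, hp⟩, hxp, hlt'⟩
      _ ≤ ∑' p : S, ∫⁻ y in dyadicCube a s p ∩
            {y | (2 ^ (n + 1)) ^ m * (2 ^ n * (2 * L)) < w y}, w y := lintegral_iUnion_le _ _
      _ ≤ ∑' p : S, (1 - (2 * K)⁻¹) ^ m * ∫⁻ y in dyadicCube a s p, w y :=
          ENNReal.tsum_le_tsum fun p => ih _ _ (by positivity) _ (hle p p.2)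
      _ = (1 - (2 * K)⁻¹) ^ m * ∫⁻ y in ⋃ p ∈ S, dyadicCube a s p, w y := by
          rw [ENNReal.tsum_mul_left, hUw]
      _ ≤ (1 - (2 * K)⁻¹) ^ m * ((1 - (2 * K)⁻¹) * ∫⁻ y in halfOpenCube a s, w y) := by
          gcongr
          exact setLIntegral_le_of_two_mul_volume_le hK hK0 hs (hfin a s hs) (hA a s hs) hUm hUQ hvol
      _ = (1 - (2 * K)⁻¹) ^ (m + 1) * ∫⁻ y in halfOpenCube a s, w y := by
          rw [pow_succ, mul_assoc]

end Decay

/-! ### Summation over the levels of the weight. -/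

/-- Summation over dyadic levels: the terms are bounded by a geometric sequence below the level `z`
and decay exponentially above it. -/
lemma tsum_int_le_of_geometric_bounds {A z ρ : ℝ≥0∞} (hA2 : 2 ≤ A) (hAt : A ≠ ∞) (hz0 : z ≠ 0)
    (hzt : z ≠ ∞) {φ : ℤ → ℝ≥0∞} (h1 : ∀ k, φ k ≤ A ^ (k + 1))
    (h2 : ∀ (k : ℤ) (m : ℕ), A ^ m * z ≤ A ^ k → φ k ≤ ρ ^ m * z) :
    ∑' k, φ k ≤ ((1 - ρ)⁻¹ + 2 * A) * z := by
  have hA0 : A ≠ 0 := (lt_of_lt_of_le two_ne_zero.bot_lt hA2).ne'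
  obtain ⟨k₀, hk⟩ := ENNReal.exists_mem_Ioc_zpow hz0 hzt (lt_of_lt_of_le ENNReal.one_lt_two hA2) hAt
  -- With `A ^ k₀ < z ≤ A ^ (k₀ + 1)`, the decay applies from `k₀ + 1` on and the trivial bound up
  -- to `k₀`.
  rw [← (Equiv.addRight (k₀ + 1)).tsum_eq φ]
  simp only [Equiv.coe_addRight]
  rw [(HasSum.of_nat_of_neg_add_one (f := fun k : ℤ => φ (k + (k₀ + 1)))
    ENNReal.summable.hasSum ENNReal.summable.hasSum).tsum_eq, add_mul]
  gcongr
  · rw [← ENNReal.tsum_geometric, ← ENNReal.tsum_mul_right]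
    refine ENNReal.tsum_le_tsum fun m => h2 _ _ ?_
    rw [ENNReal.zpow_add hA0 hAt, zpow_natCast]
    gcongr
    exact hk.2
  · calc ∑' m : ℕ, φ (-(m + 1 : ℤ) + (k₀ + 1)) ≤ ∑' m : ℕ, (2⁻¹ : ℝ≥0∞) ^ m * (A * z) := by
          refine ENNReal.tsum_le_tsum fun m => (h1 _).trans ?_
          rw [show -(m + 1 : ℤ) + (k₀ + 1) + 1 = -m + (1 + k₀) by ring, ENNReal.zpow_add hA0 hAt,
            ENNReal.zpow_add hA0 hAt, zpow_one, ENNReal.zpow_neg, zpow_natCast, ← ENNReal.inv_pow]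
          gcongr
          exact hk.1.le
      _ = 2 * A * z := by
          rw [ENNReal.tsum_mul_right, ENNReal.tsum_geometric, ENNReal.one_sub_inv_two, inv_inv,
            mul_assoc]

/-! ### Vitali covering by cubes. -/

section Covering

variable {n : ℕ}

/-- The cube concentric with `cube p.1 p.2` and five times as large, in half-open form. -/
def enlargedCube (p : (Fin n → ℝ) × ℝ) : Set (Fin n → ℝ) :=
  halfOpenCube (fun i => p.1 i - 2 * p.2) (5 * p.2)

lemma cube_subset_enlargedCube {p : (Fin n → ℝ) × ℝ} (hp : 0 < p.2) :
    cube p.1 p.2 ⊆ enlargedCube p := by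
  intro x hx
  rw [cube, ← pi_univ_Icc] at hx
  intro i hi
  have := hx i hi
  constructor <;> linarith [this.1, this.2]

lemma measurableSet_cube {a : Fin n → ℝ} {s : ℝ} : MeasurableSet (cube a s) := measurableSet_Icc

lemma volume_enlargedCube (p : (Fin n → ℝ) × ℝ) :
    volume (enlargedCube p) = 5 ^ n * volume (cube p.1 p.2) := by
  rw [enlargedCube, volume_halfOpenCube, ← measure_congr halfOpenCube_ae_eq_cube,
    volume_halfOpenCube, ENNReal.ofReal_mul (by norm_num), mul_pow]
  simp

/-- Vitali covering of the set where a truncated maximal function is large. -/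
lemma exists_disjoint_cubes_covering (g : (Fin n → ℝ) → ℝ≥0∞) (R : ℝ) (c : ℝ≥0∞) :
    ∃ S : Set ((Fin n → ℝ) × ℝ), S.Countable ∧ S.PairwiseDisjoint (fun p => cube p.1 p.2) ∧
      (∀ p ∈ S, 0 < p.2 ∧ c * volume (cube p.1 p.2) < ∫⁻ y in cube p.1 p.2, g y) ∧
      ∀ a s, 0 < s → s ≤ R → c * volume (cube a s) < ∫⁻ y in cube a s, g y →
        ∀ x ∈ cube a s, ∃ p ∈ S, x ∈ cube (fun i => p.1 i - 2 * p.2) (5 * p.2) := by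
  -- Cubes are balls of the sup norm; the bound `R` on side lengths supplies the bounded radii
  -- Vitali's lemma requires.
  obtain ⟨S, hST, hdisj, hcov⟩ := Vitali.exists_disjoint_subfamily_covering_enlargement_closedBall
    {p : (Fin n → ℝ) × ℝ | (0 < p.2 ∧ p.2 ≤ R) ∧
      c * volume (cube p.1 p.2) < ∫⁻ y in cube p.1 p.2, g y}
    (fun p i => p.1 i + p.2 / 2) (fun p => p.2 / 2) (R / 2)
    (fun p hp => by linarith [hp.1.2]) 5 (by norm_num)
  have hdisj' : S.PairwiseDisjoint fun p => cube p.1 p.2 := by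
    intro p hp q hq hpq
    have := hdisj hp hq hpq
    simp only [Function.onFun] at this ⊢
    rwa [cube_eq_closedBall (hST hp).1.1.le, cube_eq_closedBall (hST hq).1.1.le]
  refine ⟨S, ?_, hdisj', fun p hp => ⟨(hST hp).1.1, (hST hp).2⟩, fun a s hs hsR hlt x hx => ?_⟩
  · refine hdisj'.countable_of_nonempty_interior fun p hp => ?_
    have hp0 := (hST hp).1.1
    rw [cube_eq_closedBall hp0.le]
    exact (Metric.nonempty_ball.2 (by positivity)).mono Metric.ball_subset_interior_closedBall
  · obtain ⟨p, hp, hsub⟩ := hcov (a, s) ⟨⟨hs, hsR⟩, hlt⟩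
    have hp0 := (hST hp).1.1
    refine ⟨p, hp, ?_⟩
    rw [cube_eq_closedBall (by positivity)]
    rw [cube_eq_closedBall hs.le] at hx
    convert hsub hx using 2
    · ext i; ring
    · ring

end Covering

/-! ### The truncated weak type estimate. -/

section WeakType

variable {n : ℕ} {w : (Fin n → ℝ) → ℝ≥0∞} {K : ℝ≥0∞}

/-- The weak type estimate for the maximal function truncated to cubes of side length at most
`R`. -/
theorem truncated_weak_type (hw : Measurable w) (hw0 : ∀ x, w x ≠ 0) (hwt : ∀ x, w x ≠ ∞)
    (hK : K ≠ ∞) (hK1 : 1 ≤ K)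
    (hfin : ∀ (a : Fin n → ℝ) s, 0 < s → ∫⁻ y in halfOpenCube a s, w y ≠ ∞)
    (hA : ∀ (a : Fin n → ℝ) s, 0 < s → ∀ᵐ x, x ∈ halfOpenCube a s →
      ∫⁻ y in halfOpenCube a s, w y ≤ K * w x * volume (halfOpenCube a s))
    {g : (Fin n → ℝ) → ℝ≥0∞} (hg : AEMeasurable g) (R : ℝ) (t : ℝ≥0∞) :
    t * ∫⁻ x in {x | ∃ a s, (0 < s ∧ s ≤ R) ∧ x ∈ cube a s ∧
        t * w x * volume (cube a s) < ∫⁻ y in cube a s, g y}, w x ^ 2 ≤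
      2 ^ (n + 1) * 5 ^ n * (2 + 2 * 2 ^ (n + 1)) * K ^ 2 * ∫⁻ x, g x * w x := by
  have hK0 : K ≠ 0 := (lt_of_lt_of_le one_pos hK1).ne'
  set A : ℝ≥0∞ := 2 ^ (n + 1) with hAdef
  have hA2 : 2 ≤ A := by
    rw [hAdef, pow_succ']
    exact le_mul_of_one_le_right' (one_le_pow_of_one_le' one_le_two n)
  have hAt : A ≠ ∞ := ENNReal.pow_ne_top ENNReal.ofNat_ne_top
  have hA0 : A ≠ 0 := (lt_of_lt_of_le two_ne_zero.bot_lt hA2).ne'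
  choose S hSc hSd hSlt hScov using fun k : ℤ => exists_disjoint_cubes_covering g R (t * A ^ k)
  set E : ℤ → Set (Fin n → ℝ) := fun k => {x | A ^ k < w x ∧ w x ≤ A ^ (k + 1)} with hE
  have hEm : ∀ k, MeasurableSet (E k) := fun k =>
    (measurableSet_lt measurable_const hw).inter (measurableSet_le hw measurable_const)
  set φ : ℤ → (Fin n → ℝ) × ℝ → ℝ≥0∞ := fun k p =>
    (∫⁻ y in enlargedCube p ∩ E k, w y) / volume (enlargedCube p) with hφ
  have hv0 : ∀ k, ∀ p ∈ S k, volume (enlargedCube p) ≠ 0 := fun k p hp =>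
    volume_halfOpenCube_ne_zero (by linarith [(hSlt k p hp).1])
  have hvt : ∀ p : (Fin n → ℝ) × ℝ, volume (enlargedCube p) ≠ ∞ := fun p =>
    volume_halfOpenCube_ne_top
  have : ∀ k, Countable (S k) := fun k => (hSc k).to_subtype
  have hcover : {x | ∃ a s, (0 < s ∧ s ≤ R) ∧ x ∈ cube a s ∧
      t * w x * volume (cube a s) < ∫⁻ y in cube a s, g y} ⊆
      ⋃ k : ℤ, ⋃ p : S k, cube (fun i => p.1.1 i - 2 * p.1.2) (5 * p.1.2) ∩ E k := by
    rintro x ⟨a, s, ⟨hs, hsR⟩, hx, hlt⟩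
    obtain ⟨k, hk⟩ := ENNReal.exists_mem_Ioc_zpow (hw0 x) (hwt x)
      (lt_of_lt_of_le ENNReal.one_lt_two hA2) hAt
    obtain ⟨p, hp, hxp⟩ := hScov k a s hs hsR (lt_of_le_of_lt (by gcongr; exact hk.1.le) hlt) x hx
    exact mem_iUnion.2 ⟨k, mem_iUnion.2 ⟨⟨p, hp⟩, hxp, hk⟩⟩
  have hterm : ∀ k, ∀ p : S k,
      t * ∫⁻ x in cube (fun i => p.1.1 i - 2 * p.1.2) (5 * p.1.2) ∩ E k, w x ^ 2 ≤
        A * 5 ^ n * ∫⁻ x, (cube p.1.1 p.1.2).indicator (fun _ => φ k p) x * g x := by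
    rintro k ⟨p, hp⟩
    have hmass : ∫⁻ y in enlargedCube p ∩ E k, w y = φ k p * (5 ^ n * volume (cube p.1 p.2)) := by
      rw [← volume_enlargedCube, hφ, ENNReal.div_mul_cancel (hv0 k p hp) (hvt p)]
    calc t * ∫⁻ x in cube (fun i => p.1 i - 2 * p.2) (5 * p.2) ∩ E k, w x ^ 2
        = t * ∫⁻ x in enlargedCube p ∩ E k, w x ^ 2 := by
          congr 1
          exact setLIntegral_congr (halfOpenCube_ae_eq_cube.symm.inter (ae_eq_refl _))
      _ ≤ t * ∫⁻ x in enlargedCube p ∩ E k, A ^ (k + 1) * w x := by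
          refine mul_le_mul_right (setLIntegral_mono_ae'
            (measurableSet_halfOpenCube.inter (hEm k)) (ae_of_all _ fun x hx => ?_)) t
          rw [pow_two]
          gcongr
          exact hx.2.2
      _ = A * 5 ^ n * φ k p * (t * A ^ k * volume (cube p.1 p.2)) := by
          rw [lintegral_const_mul _ hw, hmass, ENNReal.zpow_add hA0 hAt, zpow_one]
          ring
      _ ≤ A * 5 ^ n * φ k p * ∫⁻ y in cube p.1 p.2, g y := by
          gcongr
          exact (hSlt k p hp).2.le
      _ = A * 5 ^ n * ∫⁻ x, (cube p.1 p.2).indicator (fun _ => φ k p) x * g x := by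
          rw [mul_assoc, ← lintegral_const_mul'' _ hg.restrict,
            ← lintegral_indicator measurableSet_cube]
          congr 2
          ext x
          by_cases hx : x ∈ cube p.1 p.2 <;> simp [hx]
  have hpt : ∀ᵐ x, ∑' k, ∑' p : S k, (cube p.1.1 p.1.2).indicator (fun _ => φ k p) x ≤
      (2 + 2 * A) * K ^ 2 * w x := by
    -- Only countably many cubes occur, so one null set serves all of them.
    have hall : ∀ᵐ x, ∀ k, ∀ p : S k, x ∈ enlargedCube p.1 →
        ∫⁻ y in enlargedCube p.1, w y ≤ K * w x * volume (enlargedCube p.1) :=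
      ae_all_iff.2 fun k => ae_all_iff.2 fun p => hA _ _ (by linarith [(hSlt k p p.2).1])
    filter_upwards [hall] with x hx
    -- Cubes of one level are disjoint, so the inner sum has at most one nonzero term.
    have hred : ∀ k, ∀ c : ℝ≥0∞, (∀ p : S k, x ∈ cube p.1.1 p.1.2 → φ k p ≤ c) →
        ∑' p : S k, (cube p.1.1 p.1.2).indicator (fun _ => φ k p) x ≤ c := by
      intro k c hc
      by_cases hex : ∃ p : S k, x ∈ cube p.1.1 p.1.2
      · obtain ⟨p, hp⟩ := hex
        rw [tsum_eq_single p, indicator_of_mem hp]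
        · exact hc p hp
        · intro q hq
          refine indicator_of_notMem (fun hxq => ?_) _
          exact (hSd k q.2 p.2 (fun h => hq (Subtype.ext h))).le_bot ⟨hxq, hp⟩
      · push Not at hex
        simp [hex]
    -- The sum of the geometric decay yields one factor `K`; the other comes from `z = K * w x`.
    have hρ : (1 - (1 - (2 * K)⁻¹))⁻¹ = 2 * K := by
      rw [ENNReal.sub_sub_cancel ENNReal.one_ne_top, inv_inv]
      exact ENNReal.inv_le_one.2 (one_le_mul one_le_two hK1)
    calc ∑' k, ∑' p : S k, (cube p.1.1 p.1.2).indicator (fun _ => φ k p) x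
        ≤ ((1 - (1 - (2 * K)⁻¹))⁻¹ + 2 * A) * (K * w x) := by
          refine tsum_int_le_of_geometric_bounds hA2 hAt (mul_ne_zero hK0 (hw0 x))
            (ENNReal.mul_ne_top hK (hwt x)) (fun k => hred k _ fun p _ => ?_)
            (fun k m hm => hred k _ fun p hp => ?_)
          · refine ENNReal.div_le_of_le_mul ?_
            calc ∫⁻ y in enlargedCube p.1 ∩ E k, w y
                ≤ ∫⁻ _ in enlargedCube p.1 ∩ E k, A ^ (k + 1) :=
                  setLIntegral_mono_ae' (measurableSet_halfOpenCube.inter (hEm k))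
                    (ae_of_all _ fun y hy => hy.2.2)
              _ ≤ A ^ (k + 1) * volume (enlargedCube p.1) := by
                  rw [setLIntegral_const]
                  gcongr
                  exact inter_subset_left
          · have hp0 := (hSlt k p p.2).1
            have hav := hx k p (cube_subset_enlargedCube hp0 hp)
            refine ENNReal.div_le_of_le_mul ?_
            calc ∫⁻ y in enlargedCube p.1 ∩ E k, w y
                ≤ ∫⁻ y in enlargedCube p.1 ∩ {y | A ^ m * (K * w x) < w y}, w y :=
                  lintegral_mono_set fun y hy => ⟨hy.1, lt_of_le_of_lt hm hy.2.1⟩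
              _ ≤ (1 - (2 * K)⁻¹) ^ m * ∫⁻ y in enlargedCube p.1, w y :=
                  setLIntegral_levelSet_le hw hK hK0 hfin hA m _ _ (by linarith) _ hav
              _ ≤ (1 - (2 * K)⁻¹) ^ m * (K * w x) * volume (enlargedCube p.1) := by
                  rw [mul_assoc]
                  gcongr
      _ = (2 * K + 2 * A) * (K * w x) := by rw [hρ]
      _ ≤ (2 * K + 2 * A * K) * (K * w x) := by
          have : 2 * A ≤ 2 * A * K := le_mul_of_one_le_right' hK1
          gcongr
      _ = (2 + 2 * A) * K ^ 2 * w x := by ring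
  have hmeas : ∀ k, ∀ p : S k, AEMeasurable
      fun x => (cube p.1.1 p.1.2).indicator (fun _ => φ k p) x * g x := fun k p =>
    ((measurable_const.indicator measurableSet_cube).aemeasurable).mul hg
  calc t * ∫⁻ x in {x | ∃ a s, (0 < s ∧ s ≤ R) ∧ x ∈ cube a s ∧
        t * w x * volume (cube a s) < ∫⁻ y in cube a s, g y}, w x ^ 2
      ≤ t * ∑' k, ∑' p : S k,
          ∫⁻ x in cube (fun i => p.1.1 i - 2 * p.1.2) (5 * p.1.2) ∩ E k, w x ^ 2 := by
        gcongr
        refine (lintegral_mono_set hcover).trans ((lintegral_iUnion_le _ _).trans ?_)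
        exact ENNReal.tsum_le_tsum fun k => lintegral_iUnion_le _ _
    _ = ∑' k, ∑' p : S k,
          t * ∫⁻ x in cube (fun i => p.1.1 i - 2 * p.1.2) (5 * p.1.2) ∩ E k, w x ^ 2 := by
        simp_rw [ENNReal.tsum_mul_left]
    _ ≤ ∑' k, ∑' p : S k,
          A * 5 ^ n * ∫⁻ x, (cube p.1.1 p.1.2).indicator (fun _ => φ k p) x * g x :=
        ENNReal.tsum_le_tsum fun k => ENNReal.tsum_le_tsum fun p => hterm k p
    _ = A * 5 ^ n * ∫⁻ x,
          (∑' k, ∑' p : S k, (cube p.1.1 p.1.2).indicator (fun _ => φ k p) x) * g x := by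
        simp_rw [ENNReal.tsum_mul_left, ← ENNReal.tsum_mul_right]
        rw [lintegral_tsum fun k => AEMeasurable.tsum fun p => hmeas k p]
        simp_rw [lintegral_tsum fun p => hmeas _ p]
    _ ≤ A * 5 ^ n * ∫⁻ x, (2 + 2 * A) * K ^ 2 * (g x * w x) := by
        refine mul_le_mul_right (lintegral_mono_ae ?_) _
        filter_upwards [hpt] with x hx
        calc _ ≤ (2 + 2 * A) * K ^ 2 * w x * g x := by gcongr
          _ = _ := by ring
    _ = A * 5 ^ n * (2 + 2 * A) * K ^ 2 * ∫⁻ x, g x * w x := by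
        rw [lintegral_const_mul'' ((2 + 2 * A) * K ^ 2) (f := fun x => g x * w x)
          (hg.mul hw.aemeasurable)]
        ring

end WeakType

/-! ### Pointwise consequences of the `A₁` condition. -/

section A1Weights

variable {n : ℕ} {u : (Fin n → ℝ) → ℝ}

/-- Every `A₁` weight agrees almost everywhere with a measurable function with values in
`(0, ∞)`. -/
lemma IsA1.exists_measurable_representative (hu : IsA1 u) :
    ∃ w : (Fin n → ℝ) → ℝ≥0∞, Measurable w ∧ (∀ x, w x ≠ 0) ∧ (∀ x, w x ≠ ∞) ∧
      ∀ᵐ x, w x = ENNReal.ofReal (u x) := by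
  have hum : AEMeasurable u volume := hu.locallyIntegrable.aestronglyMeasurable.aemeasurable
  refine ⟨fun x => ENNReal.ofReal (if 0 < hum.mk u x then hum.mk u x else 1), ?_, fun x => ?_,
    fun x => ENNReal.ofReal_ne_top, ?_⟩
  · exact (Measurable.ite (measurableSet_lt measurable_const hum.measurable_mk) hum.measurable_mk
      measurable_const).ennreal_ofReal
  · simp only [ne_eq, ENNReal.ofReal_eq_zero, not_le]
    split_ifs with h
    exacts [h, one_pos]
  · filter_upwards [hum.ae_eq_mk, hu.pos] with x hx hpos
    rw [← hx, if_pos hpos]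

variable {w : (Fin n → ℝ) → ℝ≥0∞}

lemma IsA1.setLIntegral_le (hu : IsA1 u) (hwu : ∀ᵐ x, w x = ENNReal.ofReal (u x))
    (a : Fin n → ℝ) (s : ℝ) (hs : 0 < s) :
    ∀ᵐ x, x ∈ halfOpenCube a s →
      ∫⁻ y in halfOpenCube a s, w y ≤ A1Const u * w x * volume (halfOpenCube a s) := by
  have hQc := halfOpenCube_ae_eq_cube (a := a) (s := s)
  have hv0 := volume_halfOpenCube_ne_zero (a := a) hs
  have hvt := volume_halfOpenCube_ne_top (a := a) (s := s)
  have hrestr : volume.restrict (cube a s) = volume.restrict (halfOpenCube a s) :=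
    Measure.restrict_congr_set hQc.symm
  set m := essInf (fun y => ENNReal.ofReal (u y)) (volume.restrict (cube a s)) with hm
  have hmle : ∀ᵐ x ∂volume.restrict (halfOpenCube a s), m ≤ ENNReal.ofReal (u x) := by
    rw [← hrestr]
    exact ae_essInf_le
  have hmt : m ≠ ∞ := by
    have : NeZero (volume.restrict (halfOpenCube a s)) :=
      ⟨fun h => hv0 (Measure.restrict_eq_zero.1 h)⟩
    obtain ⟨x, hx⟩ := hmle.exists
    exact ne_top_of_le_ne_top ENNReal.ofReal_ne_top hx
  have hdiv : (⨍⁻ y in cube a s, ENNReal.ofReal (u y) ∂volume) / m ≤ A1Const u := by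
    unfold A1Const
    exact le_iSup₂_of_le a s (le_iSup_of_le hs le_rfl)
  rw [ENNReal.div_le_iff_le_mul (Or.inr hu.const_lt_top.ne) (Or.inl hmt), laverage_eq,
    hrestr, Measure.restrict_apply_univ, ENNReal.div_le_iff_le_mul (Or.inl hv0) (Or.inl hvt)] at hdiv
  filter_upwards [(ae_restrict_iff' measurableSet_halfOpenCube).1 hmle, hwu] with x hx hwx hxQ
  rw [lintegral_congr_ae (ae_restrict_of_ae hwu)]
  refine hdiv.trans ?_
  rw [hwx]
  gcongr
  exact hx hxQ

/-- Evaluating the `A₁` inequality at a single good point of the cube already bounds the integral.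
-/
lemma IsA1.setLIntegral_ne_top (hu : IsA1 u) (hwt : ∀ x, w x ≠ ∞)
    (hwu : ∀ᵐ x, w x = ENNReal.ofReal (u x)) (a : Fin n → ℝ) (s : ℝ) (hs : 0 < s) :
    ∫⁻ y in halfOpenCube a s, w y ≠ ∞ := by
  have : NeZero (volume.restrict (halfOpenCube a s)) :=
    ⟨fun h => volume_halfOpenCube_ne_zero hs (Measure.restrict_eq_zero.1 h)⟩
  obtain ⟨x, hx⟩ := ((ae_restrict_iff' measurableSet_halfOpenCube).2
    (hu.setLIntegral_le hwu a s hs)).exists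
  exact ne_top_of_le_ne_top (ENNReal.mul_ne_top
    (ENNReal.mul_ne_top hu.const_lt_top.ne (hwt x)) volume_halfOpenCube_ne_top) hx

/-- Integrate the `A₁` inequality over the unit cube and cancel the positive finite mass. -/
lemma IsA1.one_le_A1Const (hu : IsA1 u) (hw : Measurable w) (hw0 : ∀ x, w x ≠ 0)
    (hwt : ∀ x, w x ≠ ∞) (hwu : ∀ᵐ x, w x = ENNReal.ofReal (u x)) : 1 ≤ A1Const u := by
  set Q : Set (Fin n → ℝ) := halfOpenCube 0 1
  have hQ : MeasurableSet Q := measurableSet_halfOpenCube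
  have hvol : volume Q = 1 := by simp [Q, volume_halfOpenCube]
  have hIt : ∫⁻ y in Q, w y ≠ ∞ := hu.setLIntegral_ne_top hwt hwu 0 1 one_pos
  have hI0 : ∫⁻ y in Q, w y ≠ 0 := by
    rw [← pos_iff_ne_zero, setLIntegral_pos_iff hw,
      show Function.support w = univ from eq_univ_of_forall hw0, univ_inter, hvol]
    exact one_pos
  refine (ENNReal.mul_le_mul_iff_left hI0 hIt).1 ?_
  calc 1 * ∫⁻ y in Q, w y = ∫⁻ _ in Q, (∫⁻ y in Q, w y) := by
        rw [setLIntegral_const, hvol, one_mul, mul_one]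
    _ ≤ ∫⁻ x in Q, A1Const u * w x := by
        refine setLIntegral_mono_ae' hQ ?_
        filter_upwards [hu.setLIntegral_le hwu 0 1 one_pos] with x hx hxQ
        have := hx hxQ
        rwa [show volume (halfOpenCube (0 : Fin n → ℝ) 1) = 1 from hvol, mul_one] at this
    _ = A1Const u * ∫⁻ y in Q, w y := lintegral_const_mul _ hw

end A1Weights

end WeightedBounds

/-! ### Removal of the truncation. -/

open WeightedBounds in
theorem mainTheorem6 (n : ℕ) (hn : 1 ≤ n) :
    ∃ c : ℝ≥0, ∀ u : (Fin n → ℝ) → ℝ, WeightedBounds.IsA1 u →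
      ∀ f : (Fin n → ℝ) → ℂ, AEStronglyMeasurable f volume →
        WeightedBounds.weakL1Norm
            (fun x => WeightedBounds.maximalFunction (fun y => f y * (u y : ℂ)) x /
              ENNReal.ofReal (u x))
            (WeightedBounds.weightMeasure (fun x => u x ^ 2)) ≤
          (c : ℝ≥0∞) * WeightedBounds.A1Const u ^ 2 *
            eLpNorm f 1 (WeightedBounds.weightMeasure (fun x => u x ^ 2)) := by
  -- The factors come from the slicing ratio, the Vitali enlargement and the sum over levels.
  refine ⟨2 ^ (n + 1) * 5 ^ n * (2 + 2 * 2 ^ (n + 1)), fun u hu f hf => ?_⟩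
  obtain ⟨w, hw, hw0, hwt, hwu⟩ := hu.exists_measurable_representative
  set g : (Fin n → ℝ) → ℝ≥0∞ := fun y => ‖f y * (u y : ℂ)‖ₑ with hg
  have hgw : ∀ᵐ x, g x = ‖f x‖ₑ * w x := by
    filter_upwards [hwu, hu.pos] with x hx hpos
    simp only [hg]
    rw [hx, enorm_mul, ← Real.enorm_of_nonneg hpos.le]
    simp [enorm_eq_nnnorm]
  have hgm : AEMeasurable g := (hf.enorm.mul hw.aemeasurable).congr (hgw.mono fun x hx => hx.symm)
  have hν : weightMeasure (fun x => u x ^ 2) = volume.withDensity fun x => w x ^ 2 := by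
    refine withDensity_congr_ae ?_
    filter_upwards [hwu, hu.pos] with x hx hpos
    rw [hx, ENNReal.ofReal_pow hpos.le]
  have hnorm : eLpNorm f 1 (weightMeasure fun x => u x ^ 2) = ∫⁻ x, g x * w x := by
    rw [hν, eLpNorm_one_eq_lintegral_enorm,
      lintegral_withDensity_eq_lintegral_mul₀ (hw.pow_const 2).aemeasurable hf.enorm]
    refine lintegral_congr_ae ?_
    filter_upwards [hgw] with x hx
    rw [hx, Pi.mul_apply]
    ring
  refine iSup₂_le fun t _ => ?_
  -- The truncated level sets increase with `R`, so a bound uniform in `R` passes to their union.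
  set T : ℕ → Set (Fin n → ℝ) := fun R => {x | ∃ a s, (0 < s ∧ s ≤ (R : ℝ)) ∧ x ∈ cube a s ∧
    (t : ℝ≥0∞) * w x * volume (cube a s) < ∫⁻ y in cube a s, g y} with hT
  have hTmono : Monotone T := by
    rintro R R' hR x ⟨a, s, ⟨hs, hsR⟩, h⟩
    exact ⟨a, s, ⟨hs, hsR.trans (by exact_mod_cast hR)⟩, h⟩
  have hsub : ∀ᵐ x, x ∈ {x | (t : ℝ≥0∞) <
      maximalFunction (fun y => f y * (u y : ℂ)) x / ENNReal.ofReal (u x)} → x ∈ ⋃ R, T R := by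
    filter_upwards [hwu] with x hx hlt
    rw [← hx, ENNReal.lt_div_iff_mul_lt (Or.inl (hw0 x)) (Or.inl (hwt x)),
      maximalFunction] at hlt
    simp only [lt_iSup_iff] at hlt
    obtain ⟨a, s, hs, hxs, hlt⟩ := hlt
    rw [setLAverage_eq, ENNReal.lt_div_iff_mul_lt] at hlt
    · obtain ⟨R, hR⟩ := exists_nat_ge s
      exact Set.mem_iUnion.2 ⟨R, a, s, ⟨hs, hR⟩, hxs, hlt⟩
    · rw [← measure_congr halfOpenCube_ae_eq_cube]
      exact Or.inl (volume_halfOpenCube_ne_zero hs)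
    · rw [← measure_congr halfOpenCube_ae_eq_cube]
      exact Or.inl volume_halfOpenCube_ne_top
  rw [hnorm, hν]
  calc (t : ℝ≥0∞) * (volume.withDensity fun x => w x ^ 2) {x | (t : ℝ≥0∞) <
        maximalFunction (fun y => f y * (u y : ℂ)) x / ENNReal.ofReal (u x)}
      ≤ t * (volume.withDensity fun x => w x ^ 2) (⋃ R, T R) := by
        refine mul_le_mul_right (measure_mono_ae ?_) _
        exact (withDensity_absolutelyContinuous _ _).ae_le hsub
    _ = ⨆ R, t * ∫⁻ x in T R, w x ^ 2 := by
        rw [hTmono.measure_iUnion, ENNReal.mul_iSup]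
        simp_rw [withDensity_apply']
    _ ≤ _ := by
        refine iSup_le fun R => ?_
        push_cast
        exact truncated_weak_type hw hw0 hwt hu.const_lt_top.ne
          (hu.one_le_A1Const hw hw0 hwt hwu) (hu.setLIntegral_ne_top hwt hwu)
          (hu.setLIntegral_le hwu) hgm R t
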